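/- For $e\in\{0,1\}^*\cup\{2\}^*$ let $L_e=\{x\in\{0,1\}^{|e|}: x\neq e\}$. The class $\{L_e: e\in\{0,1\}^*\cup\{2\}^*\}$ cannot be learnt in the limit, with respect to any hypothesis space, by a linear-time learner using a length-bounded base tape and one additional stack. Here the notions are as follows. A text for a language $L$ is an infinite sequence $w_0,w_1,\ldots$ of words with $\{w_n:n\ge 0\}=L$. A hypothesis space is a family $(H_e)_{e\in J}$ of languages whose index set $J$ is a set of words over a finite alphabet. A learner $M$ is a deterministic Turing machine with a one-sided infinite base tape, whose left end is marked by an unmodifiable symbol $\boxplus$ and whose empty cells hold $\boxdot$, and with one stack; the stack is initially empty, in each step $M$ sees the scanned base tape symbol and the top of the stack, and it can push or pop at most one symbol. $M$ works in cycles $n=0,1,2,\ldots$. At the beginning of cycle $n$, $M$ is in its start state with its head on $\boxplus$, the base tape contains $\boxplus\,\mathrm{conv}(w_n,\mathit{mem}_n)\boxdot\boxdot\cdots$, where $\mathit{mem}_n$ is the current long term memory (a word over a finite alphabet, with $\mathit{mem}_0$ fixed), and the stack is as it was left by the previous cycle. The cycle ends when $M$ enters an accepting state, at which time the content of the base tape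 must begin with $\boxplus\,\mathrm{conv}(\mathit{mem}_{n+1},e_n)\boxdot$ for some new memory $\mathit{mem}_{n+1}$ and conjecture $e_n$. (The convolution $\mathrm{conv}(x,y)$ of two words is the word of length $\max\{|x|,|y|\}$ whose $i$-th symbol is the pair of the $i$-th symbols of $x$ and $y$, the shorter word being padded by a special symbol.) $M$ is a linear-time learner with length-bounded base tape which learns a class $\mathcal C$ if there are constants $c,d$ such that for every $L\in\mathcal C$ and every text $w_0,w_1,\ldots$ for $L$, with $N_n=\max_{i\le n}|w_i|$: every cycle $n$ ends after at most $c\cdot(N_n+1)$ steps with $|\mathit{mem}_{n+1}|,|e_n|\le N_n+d$, and there are $e\in J$ and $k$ such that $H_e=L$ and $e_n=e$ for all $n\ge k$. -/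

import Mathlib

namespace StackLearning

/-- Symbols of the cells of the base tape to the right of the left end marker: the blank `⊡`,
the symbols of convolutions of a datum (over `σ`) with a memory word (over `γ`), the symbols of
convolutions of a memory word with a hypothesis (over `η`), and further work symbols. In a
convolution, `none` is the padding of the shorter word. -/
inductive BaseSym (σ η γ ω : Type) : Type
  | blank : BaseSym σ η γ ω
  | input (x : Option σ) (m : Option γ) : BaseSym σ η γ ω
  | output (m : Option γ) (h : Option η) : BaseSym σ η γ ω
  | work (a : ω) : BaseSym σ η γ ω

/-- Head movements on the base tape. -/
inductive Dir : Type
  | left : Dir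
  | stay : Dir
  | right : Dir

/-- The action on the stack in one step. -/
inductive StackOp (κ : Type) : Type
  | keep : StackOp κ
  | push (a : κ) : StackOp κ
  | pop : StackOp κ

/-- The stack is a list whose head is the top symbol; popping an empty stack has no effect. -/
def StackOp.apply {κ : Type} : StackOp κ → List κ → List κ
  | StackOp.keep, s => s
  | StackOp.push a, s => a :: s
  | StackOp.pop, s => s.tail

/-- A deterministic Turing machine with a one-sided infinite base tape and one stack, which reads
data over the alphabet `σ` and conjectures hypotheses over the alphabet `η`.
In the transition function, the second argument is the scanned base tape symbol, with `none`
standing for the left end marker `⊞`, and the third argument is the top symbol of the stack, with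
`none` standing for the empty stack. -/
structure Learner (σ η : Type) where
  /-- states -/
  State : Type
  /-- alphabet of the long term memory on the base tape -/
  Mem : Type
  /-- further symbols which may be used on the base tape during a cycle -/
  Work : Type
  /-- stack alphabet -/
  Stk : Type
  finite_state : Finite State
  finite_mem : Finite Mem
  finite_work : Finite Work
  finite_stk : Finite Stk
  start : State
  accept : State → Bool
  trans : State → Option (BaseSym σ η Mem Work) → Option Stk →
    State × BaseSym σ η Mem Work × Dir × StackOp Stk
  /-- the long term memory before the first cycle -/
  initMem : List Mem

namespace Learner

variable {σ η : Type}

/-- Configurations. Head position `0` is the cell with the left end marker `⊞`, and `tape i` is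
the content of the cell at position `i + 1`. -/
structure Config (M : Learner σ η) where
  state : M.State
  tape : ℕ → BaseSym σ η M.Mem M.Work
  head : ℕ
  stack : List M.Stk

/-- The scanned symbol of the base tape; `none` is the left end marker. -/
def scan (M : Learner σ η) (c : M.Config) : Option (BaseSym σ η M.Mem M.Work) :=
  match c.head with
  | 0 => none
  | i + 1 => some (c.tape i)

/-- Overwrite the scanned cell; the left end marker cannot be modified. -/
def write (M : Learner σ η) (c : M.Config) (a : BaseSym σ η M.Mem M.Work) :
    ℕ → BaseSym σ η M.Mem M.Work :=
  match c.head with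
  | 0 => c.tape
  | i + 1 => Function.update c.tape i a

/-- New head position; the head does not move to the left of the left end marker. -/
def moveHead : Dir → ℕ → ℕ
  | Dir.left, p => p - 1
  | Dir.stay, p => p
  | Dir.right, p => p + 1

/-- One step of the machine, which halts as soon as it enters an accepting state. -/
def step (M : Learner σ η) (c : M.Config) : M.Config :=
  if M.accept c.state then c
  else
    let r := M.trans c.state (M.scan c) c.stack.head?
    { state := r.1
      tape := M.write c r.2.1
      head := moveHead r.2.2.1 c.head
      stack := r.2.2.2.apply c.stack }

/-- The tape `⊞ u ⊡ ⊡ ⊡ …`. -/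
def tapeOf {γ ω : Type} (u : List (BaseSym σ η γ ω)) : ℕ → BaseSym σ η γ ω :=
  fun i => (u[i]?).getD BaseSym.blank

/-- The configuration at the beginning of a cycle: the base tape holds the convolution of the
current datum and the old long term memory, the head is on the left end marker, and the stack is
as the previous cycle has left it. -/
def startConfig (M : Learner σ η) (mem : List M.Mem) (stk : List M.Stk) (w : List σ) :
    M.Config where
  state := M.start
  tape := tapeOf (List.zipWithAll BaseSym.input w mem)
  head := 0
  stack := stk

/-- The content of the tape begins with `⊞ u ⊡`. -/
def Holds {γ ω : Type} (t : ℕ → BaseSym σ η γ ω) (u : List (BaseSym σ η γ ω)) : Prop :=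
  ∀ i ≤ u.length, t i = tapeOf u i

/-- Started with long term memory `mem`, stack content `stk` and datum `w`, the machine reaches an
accepting state within `b` steps, the base tape then holds the convolution of the new long term
memory `mem'` and the conjecture `hyp`, and the stack content is `stk'`. -/
def Cycle (M : Learner σ η) (b : ℕ) (mem : List M.Mem) (stk : List M.Stk) (w : List σ)
    (mem' : List M.Mem) (hyp : List η) (stk' : List M.Stk) : Prop :=
  ∃ t ≤ b, ∃ c : M.Config, c = M.step^[t] (M.startConfig mem stk w) ∧
    M.accept c.state = true ∧
    Holds c.tape (List.zipWithAll BaseSym.output mem' hyp) ∧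
    c.stack = stk'

/-- The length of the longest of the data `T 0, …, T n`. -/
def longest (T : ℕ → List σ) (n : ℕ) : ℕ :=
  (Finset.range (n + 1)).sup fun i => (T i).length

/-- On the data sequence `T`, the machine runs forever through its cycles, conjecturing `hyp n`
after having read `T n`. With `N` the length of the longest datum seen so far, each
cycle takes at most `c * (N + 1)` steps and leaves a convolution of memory and conjecture of
length at most `N + d` on the base tape. The stack is empty at the beginning. -/
def Run (M : Learner σ η) (c d : ℕ) (T : ℕ → List σ) (hyp : ℕ → List η) : Prop :=
  ∃ (mem : ℕ → List M.Mem) (stk : ℕ → List M.Stk),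
    mem 0 = M.initMem ∧ stk 0 = [] ∧
    ∀ n, M.Cycle (c * (longest T n + 1)) (mem n) (stk n) (T n)
        (mem (n + 1)) (hyp n) (stk (n + 1)) ∧
      (mem (n + 1)).length ≤ longest T n + d ∧
      (hyp n).length ≤ longest T n + d

end Learner

/-- A text for a language lists all its elements and nothing else, in any order, with
repetitions allowed. -/
def IsText {σ : Type} (T : ℕ → List σ) (L : Set (List σ)) : Prop :=
  Set.range T = L

/-- `M` is a linear-time learner with length-bounded base tape and one additional stack
which learns the class `C` in the limit, using the hypothesis space `(H e)` with `e ∈ J`. -/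
def Learner.LinearTimeLearns {σ η : Type} (M : Learner σ η) (J : Set (List η))
    (H : List η → Set (List σ)) (C : Set (Set (List σ))) : Prop :=
  ∃ c d : ℕ, ∀ L ∈ C, ∀ T : ℕ → List σ, IsText T L →
    ∃ hyp : ℕ → List η, M.Run c d T hyp ∧
      ∃ e ∈ J, H e = L ∧ ∃ k, ∀ n ≥ k, hyp n = e

/-- The index set `{0,1}* ∪ {2}*`. -/
def indexSet : Set (List (Fin 3)) :=
  {e | (∀ a ∈ e, a = 0 ∨ a = 1) ∨ (∀ a ∈ e, a = 2)}

/-- The language of all binary words of the same length as `e` which differ from `e`. -/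
def lang (e : List (Fin 3)) : Set (List (Fin 3)) :=
  {x | x.length = e.length ∧ (∀ a ∈ x, a = 0 ∨ a = 1) ∧ x ≠ e}

end StackLearning

/-! Fix a length n and treat the 2^n binary words of length n as letters. A cycle of at most c(n+1)
steps sees only the c(n+1) topmost stack symbols. This visible part and the memory, together the
signature, take only K = 2^O(n) values. The stack can record everything, but what lies deep can be
read only after popping what lies above it.

For every nonempty set P of letters, `exists_loop` gives a word with letter set P after which a
loop, also with letter set P, restores the signature without lowering the stack. For a large
constant r there are so many r-sets that pigeonholing (`confusable_of_lt_choose`) yields many with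
one signature, all lacking a letter x of a further such set P₁. Continue after the word of one of
them, P. If the stack need not drop, the difference between P and P₁ lies buried for good, and a
text without x gets the same conjectures as a text with x. If it always drops, the record of the
loop just read is popped, and two loops with different letters lead to the same configuration.
Either way some text for all words and some text for all words but one finally receive the same
conjectures. -/

namespace StackLearning

/-! ### Initial segments and recurrent sequences -/

/-- The list of the first `k` values of a sequence. -/
def initialSegment {X : Type*} (w : ℕ → X) (k : ℕ) : List X :=
  (List.range k).map w

section initialSegment

variable {X : Type*}

theorem initialSegment_succ (w : ℕ → X) (k : ℕ) :
    initialSegment w (k + 1) = initialSegment w k ++ [w k] := by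
  simp [initialSegment, List.range_succ]

theorem initialSegment_add (w : ℕ → X) (a b : ℕ) :
    initialSegment w (a + b) = initialSegment w a ++ initialSegment (fun i => w (a + i)) b := by
  simp [initialSegment, List.range_add, Function.comp_def]

theorem mem_initialSegment {w : ℕ → X} {k : ℕ} {x : X} :
    x ∈ initialSegment w k ↔ ∃ i < k, w i = x := by
  simp [initialSegment]

theorem prefix_initialSegment {w : ℕ → X} {k : ℕ} {y : List X} (h : y <+: initialSegment w k) :
    ∃ i ≤ k, y = initialSegment w i := by
  refine ⟨y.length, ?_, ?_⟩
  · simpa [initialSegment] using h.length_le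
  · have h1 := List.prefix_iff_eq_take.1 h
    have h2 : y.length ≤ k := by simpa [initialSegment] using h.length_le
    rw [h1, initialSegment, ← List.map_take, List.take_range]
    simp [initialSegment, h2]

end initialSegment

/-- A finite set is the range of a sequence in which all its elements occur in every interval of
some fixed length. -/
theorem exists_recurrent_sequence {X : Type*} (P : Finset X) (hP : P.Nonempty) :
    ∃ (p : ℕ → X) (r : ℕ), (∀ t, p t ∈ P) ∧
      ∀ a ∈ P, ∀ n, ∃ t, n ≤ t ∧ t < n + r ∧ p t = a := by
  have hr : 0 < P.card := hP.card_pos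
  refine ⟨fun t => P.equivFin.symm ⟨t % P.card, Nat.mod_lt _ hr⟩, P.card, fun t => ?_, ?_⟩
  · exact (P.equivFin.symm _).2
  · intro a ha n
    obtain ⟨i, hi⟩ : ∃ i, i = P.equivFin ⟨a, ha⟩ := ⟨_, rfl⟩
    have key : ∀ k, (P.equivFin.symm ⟨(P.card * k + i) % P.card, Nat.mod_lt _ hr⟩ : X) = a := by
      intro k
      have h : (⟨(P.card * k + i) % P.card, Nat.mod_lt _ hr⟩ : Fin P.card) = i :=
        Fin.ext ((Nat.mul_add_mod _ _ _).trans (Nat.mod_eq_of_lt i.2))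
      rw [h, hi, Equiv.symm_apply_apply]
    have h1 := Nat.div_add_mod n P.card
    have h2 := Nat.mod_lt n hr
    have h3 := i.2
    rcases le_or_gt (n % P.card) i with h | h
    · exact ⟨P.card * (n / P.card) + i, by omega, by omega, key _⟩
    · exact ⟨P.card * (n / P.card + 1) + i, by rw [mul_add]; omega, by rw [mul_add]; omega, key _⟩

/-! ### Stack transducers: signatures, loops and confusable texts -/

/-- A machine with finite or infinite memory `M` and a stack over `A`, which reads letters from
`X`, gives an output in `H` for every letter and, while it reads one letter, only depends on the
`depth` topmost symbols of the stack. -/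
structure StackTransducer (X M A H : Type*) where
  depth : ℕ
  next : M × List A → X → M × List A
  out : M × List A → X → H
  locality : ∀ m u x, depth ≤ u.length →
    ∃ m' u' h, ∀ v, next (m, u ++ v) x = (m', u' ++ v) ∧ out (m, u ++ v) x = h

namespace StackTransducer

variable {X M A H : Type*} (S : StackTransducer X M A H)

/-- The configuration reached by reading a finite word. -/
def run (q : M × List A) (y : List X) : M × List A :=
  y.foldl S.next q

@[simp] theorem run_nil (q : M × List A) : S.run q [] = q := rfl

theorem run_append (q : M × List A) (y z : List X) : S.run q (y ++ z) = S.run (S.run q y) z := by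
  simp [run]

theorem run_concat (q : M × List A) (y : List X) (x : X) :
    S.run q (y ++ [x]) = S.next (S.run q y) x := by
  simp [run]

/-- The stack is never shorter than at the beginning while the word is read. -/
def Stays (q : M × List A) (y : List X) : Prop :=
  ∀ z, z <+: y → q.2.length ≤ (S.run q z).2.length

/-- Signature of a configuration: the memory and the visible part of the stack. -/
abbrev Sig := M × {l : List A // l.length ≤ S.depth}

/-- The signature of a configuration. -/
def sig (q : M × List A) : S.Sig :=
  (q.1, ⟨q.2.take S.depth, List.length_take_le _ _⟩)

variable {S}

theorem Stays.of_prefix {q : M × List A} {y z : List X} (h : S.Stays q y) (hz : z <+: y) :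
    S.Stays q z :=
  fun _ ht => h _ (ht.trans hz)

theorem stays_nil (q : M × List A) : S.Stays q [] := by
  intro z hz
  rw [List.prefix_nil.1 hz]; rfl

theorem stays_concat {q : M × List A} {y : List X} {x : X} :
    S.Stays q (y ++ [x]) ↔ S.Stays q y ∧ q.2.length ≤ (S.run q (y ++ [x])).2.length := by
  constructor
  · exact fun h => ⟨h.of_prefix (List.prefix_append _ _), h _ List.prefix_rfl⟩
  · rintro ⟨h1, h2⟩ z hz
    rcases List.prefix_concat_iff.1 hz with rfl | hz
    · exact h2
    · exact h1 z hz

theorem Stays.append {q : M × List A} {y z : List X} (h : S.Stays q y)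
    (h' : S.Stays (S.run q y) z) : S.Stays q (y ++ z) := by
  intro t ht
  rcases List.prefix_or_prefix_of_prefix ht (List.prefix_append y z) with ht' | ⟨t, rfl⟩
  · exact h t ht'
  · rw [run_append]
    exact (h y List.prefix_rfl).trans (h' t ((List.prefix_append_right_inj y).1 ht))

/-- A stack with fewer than `depth` symbols is entirely visible. This settles the shallow case of
the lemmas below, where `locality` is not available. -/
theorem eq_of_sig_eq {q q' : M × List A} (h : S.sig q = S.sig q') (hq : q.2.length < S.depth) :
    q = q' := by
  obtain ⟨m, l⟩ := q
  obtain ⟨m', l'⟩ := q'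
  simp only [sig, Prod.mk.injEq, Subtype.mk.injEq] at h hq
  obtain ⟨rfl, h⟩ := h
  rw [List.take_of_length_le hq.le] at h
  have : l'.length ≤ S.depth := by
    by_contra hc
    rw [h, List.length_take] at hq
    omega
  rw [List.take_of_length_le this] at h
  rw [h]

/-- While the stack is no lower than at the start, at least `depth` symbols lie above the initially
invisible part. So `locality` applies to every letter, and both computations act alike on different
bottoms. -/
theorem Stays.exists_aligned {q q' : M × List A} {y : List X} (h : S.sig q = S.sig q')
    (hq : S.depth ≤ q.2.length) (hy : S.Stays q y) :
    ∃ m u, S.depth ≤ u.length ∧ S.run q y = (m, u ++ q.2.drop S.depth) ∧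
      S.run q' y = (m, u ++ q'.2.drop S.depth) := by
  induction y using List.reverseRecOn with
  | nil =>
    refine ⟨q.1, q.2.take S.depth, by simp [hq], by simp, ?_⟩
    simp only [sig, Prod.mk.injEq, Subtype.mk.injEq] at h
    rw [h.1, h.2]; simp
  | append_singleton y x ih =>
    obtain ⟨hy, hx⟩ := stays_concat.1 hy
    obtain ⟨m, u, hu, h1, h2⟩ := ih hy
    obtain ⟨m', u', o, hl⟩ := S.locality m u x hu
    rw [run_concat, h1, (hl _).1] at hx
    refine ⟨m', u', ?_, ?_, ?_⟩
    · simp at hx; omega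
    · rw [run_concat, h1, (hl _).1]
    · rw [run_concat, h2, (hl _).1]

theorem Stays.sig_run_eq {q q' : M × List A} {y : List X} (hy : S.Stays q y)
    (h : S.sig q = S.sig q') : S.sig (S.run q y) = S.sig (S.run q' y) := by
  rcases lt_or_ge q.2.length S.depth with hq | hq
  · rw [eq_of_sig_eq h hq]
  · obtain ⟨m, u, hu, h1, h2⟩ := hy.exists_aligned h hq
    simp [h1, h2, sig, List.take_append_of_le_length hu]

theorem Stays.out_run_eq {q q' : M × List A} {y : List X} (hy : S.Stays q y)
    (h : S.sig q = S.sig q') (x : X) : S.out (S.run q y) x = S.out (S.run q' y) x := by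
  rcases lt_or_ge q.2.length S.depth with hq | hq
  · rw [eq_of_sig_eq h hq]
  · obtain ⟨m, u, hu, h1, h2⟩ := hy.exists_aligned h hq
    obtain ⟨m', u', o, hl⟩ := S.locality m u x hu
    rw [h1, h2, (hl _).2, (hl _).2]

theorem Stays.congr {q q' : M × List A} {y : List X} (hy : S.Stays q y)
    (h : S.sig q = S.sig q') : S.Stays q' y := by
  rcases lt_or_ge q.2.length S.depth with hq | hq
  · rwa [← eq_of_sig_eq h hq]
  · intro z hz
    obtain ⟨m, u, hu, h1, h2⟩ := (hy.of_prefix hz).exists_aligned h hq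
    rw [h2]
    simp
    omega

/-- When the stack first gets shorter than at the beginning, only a bounded amount of information
on the word has been kept. -/
theorem Stays.exists_of_dip {q : M × List A} {y : List X} {x : X} (hy : S.Stays q y)
    (hx : ¬ S.Stays q (y ++ [x])) :
    ∃ k : S.Sig, S.run q (y ++ [x]) = (k.1, k.2.1 ++ q.2.drop S.depth) := by
  have hx : (S.run q (y ++ [x])).2.length < q.2.length := by
    by_contra hc
    exact hx (stays_concat.2 ⟨hy, not_lt.1 hc⟩)
  rcases lt_or_ge q.2.length S.depth with hq | hq
  · refine ⟨((S.run q (y ++ [x])).1, ⟨(S.run q (y ++ [x])).2, by omega⟩), ?_⟩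
    simp [List.drop_eq_nil_of_le hq.le]
  · obtain ⟨m, u, hu, h1, -⟩ := hy.exists_aligned rfl hq
    obtain ⟨m', u', o, hl⟩ := S.locality m u x hu
    have h2 : S.run q (y ++ [x]) = (m', u' ++ q.2.drop S.depth) := by
      rw [run_concat, h1, (hl _).1]
    rw [h2] at hx
    refine ⟨(m', ⟨u', ?_⟩), h2⟩
    simp at hx
    omega

variable (S) in
/-- From configurations with signature `σ`, reading `z` leads back to this signature and never
needs the invisible part of the stack. -/
def IsLoop (σ : S.Sig) (z : List X) : Prop :=
  ∀ q, S.sig q = σ → S.Stays q z ∧ S.sig (S.run q z) = σ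

theorem isLoop_nil (σ : S.Sig) : S.IsLoop σ [] :=
  fun q hq => ⟨stays_nil q, hq⟩

theorem IsLoop.append {σ : S.Sig} {y z : List X} (hy : S.IsLoop σ y) (hz : S.IsLoop σ z) :
    S.IsLoop σ (y ++ z) := by
  intro q hq
  obtain ⟨h1, h2⟩ := hy q hq
  obtain ⟨h3, h4⟩ := hz _ h2
  exact ⟨h1.append h3, by rw [run_append, h4]⟩

theorem Stays.isLoop {q : M × List A} {z : List X} (h : S.Stays q z)
    (hs : S.sig (S.run q z) = S.sig q) : S.IsLoop (S.sig q) z :=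
  fun q' hq' => ⟨h.congr hq'.symm, by rw [← h.sig_run_eq hq'.symm, hs]⟩

theorem isLoop_flatMap {ι : Type*} {σ : S.Sig} {z : ι → List X} (l : List ι)
    (h : ∀ i ∈ l, S.IsLoop σ (z i)) : S.IsLoop σ (l.flatMap z) := by
  induction l with
  | nil => exact isLoop_nil σ
  | cons i l ih =>
    rw [List.flatMap_cons]
    exact (h i (by simp)).append (ih fun j hj => h j (by simp [hj]))

/-- Read a recurrent sequence over `P` and look at the times after which the stack is never lower.
There are infinitely many of them, so two have the same signature, and the segment between them is a
loop. -/
theorem exists_loop [Finite M] [Finite A] (q₀ : M × List A) (P : Finset X) (hP : P.Nonempty) :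
    ∃ s z : List X, (∀ a, a ∈ s ↔ a ∈ P) ∧ (∀ a, a ∈ z ↔ a ∈ P) ∧
      S.IsLoop (S.sig (S.run q₀ s)) z := by
  obtain ⟨p, r, hp, hr⟩ := exists_recurrent_sequence P hP
  let h : ℕ → ℕ := fun t => (S.run q₀ (initialSegment p t)).2.length
  have hmin : ∀ n, ∃ t ≥ n, ∀ t' ≥ t, h t ≤ h t' := by
    intro n
    obtain ⟨t, ht, hm⟩ := (measure h).wf.has_min {t | n ≤ t} ⟨n, le_refl n⟩
    exact ⟨t, ht, fun t' ht' => not_lt.1 (hm t' (le_trans ht ht'))⟩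
  choose τ hτ hτm using hmin
  -- Gaps of at least `r`, and a start not before `r`, make both words contain every letter of `P`.
  let t : ℕ → ℕ := fun k => Nat.rec (τ r) (fun _ a => τ (a + r)) k
  have ht : ∀ k, t k + r ≤ t (k + 1) := fun k => hτ _
  have htm : ∀ k, ∀ t' ≥ t k, h (t k) ≤ h t' := by
    rintro (_ | k)
    · exact hτm r
    · exact hτm _
  have htmono : Monotone t := monotone_nat_of_le_succ fun k => by have := ht k; omega
  have : Finite {l : List A // l.length ≤ S.depth} := List.finite_length_le A S.depth
  obtain ⟨i, j, hij, hs⟩ : ∃ i j, i < j ∧ S.sig (S.run q₀ (initialSegment p (t i))) =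
      S.sig (S.run q₀ (initialSegment p (t j))) := by
    obtain ⟨i, j, hij, h⟩ := Finite.exists_ne_map_eq_of_infinite
      fun k => S.sig (S.run q₀ (initialSegment p (t k)))
    rcases lt_or_gt_of_ne hij with hlt | hlt
    · exact ⟨i, j, hlt, h⟩
    · exact ⟨j, i, hlt, h.symm⟩
  have hge : t i + r ≤ t j := (ht i).trans (htmono hij)
  have h0 : r ≤ t i := (hτ r).trans (htmono (Nat.zero_le i))
  obtain ⟨n, hn⟩ := Nat.exists_eq_add_of_le hge
  refine ⟨initialSegment p (t i), initialSegment (fun k => p (t i + k)) (r + n), ?_, ?_, ?_⟩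
  · intro a
    rw [mem_initialSegment]
    refine ⟨fun ⟨i, _, h⟩ => h ▸ hp i, fun ha => ?_⟩
    obtain ⟨b, -, hb, rfl⟩ := hr a ha 0
    exact ⟨b, by omega, rfl⟩
  · intro a
    rw [mem_initialSegment]
    refine ⟨fun ⟨i, _, h⟩ => h ▸ hp _, fun ha => ?_⟩
    obtain ⟨b, hb1, hb, rfl⟩ := hr a ha (t i)
    exact ⟨b - t i, by omega, by congr 1; omega⟩
  · refine Stays.isLoop (fun y hy => ?_) ?_
    · obtain ⟨b, -, rfl⟩ := prefix_initialSegment hy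
      rw [← run_append, ← initialSegment_add]
      exact htm i _ (by omega)
    · rw [← run_append, ← initialSegment_add, hs, hn, add_assoc]

variable (S) in
/-- Two words can be continued in the same way to a text for the set of all letters except `x` and
to a text for the set of all letters, respectively, such that the outputs are the same from then
on. -/
def Confusable (q₀ : M × List A) : Prop :=
  ∃ (x : X) (s s' : List X) (w : ℕ → X),
    (∀ a, (a ∈ s ∨ a ∈ Set.range w) ↔ a ≠ x) ∧ (∀ a, a ∈ s' ∨ a ∈ Set.range w) ∧
    ∀ k a, S.out (S.run q₀ (s ++ initialSegment w k)) a =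
      S.out (S.run q₀ (s' ++ initialSegment w k)) a

theorem confusable_of_run_eq [Countable X] {q₀ : M × List A} {x b : X} {s s' : List X}
    (hb : b ≠ x) (hx : x ∉ s) (hx' : x ∈ s') (h : S.run q₀ s = S.run q₀ s') :
    S.Confusable q₀ := by
  obtain ⟨w, hw⟩ := ({x}ᶜ : Set X).to_countable.exists_eq_range ⟨b, hb⟩
  refine ⟨x, s, s', w, fun a => ?_, fun a => ?_, fun k a => by rw [run_append, run_append, h]⟩
  · rw [← hw]
    simp only [Set.mem_compl_iff, Set.mem_singleton_iff, or_iff_right_iff_imp]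
    rintro ha rfl
    exact hx ha
  · rw [← hw, Set.mem_compl_iff, Set.mem_singleton_iff, or_iff_not_imp_right, not_not]
    rintro rfl
    exact hx'

/-- At the first drop below the initial height, `Stays.exists_of_dip` applies. This cannot happen
within `z`. -/
theorem exists_dip {q : M × List A} {z : List X} {w : ℕ → X} (hz : S.Stays q z)
    (h : ¬ ∀ k, S.Stays q (z ++ initialSegment w k)) :
    ∃ (k : ℕ) (κ : S.Sig),
      S.run q (z ++ initialSegment w k) = (κ.1, κ.2.1 ++ q.2.drop S.depth) := by
  classical
  push Not at h
  obtain ⟨k, hk⟩ : ∃ k, Nat.find h = k + 1 := by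
    refine Nat.exists_eq_succ_of_ne_zero fun h0 => ?_
    have := Nat.find_spec h
    rw [h0] at this
    exact this (by simpa [initialSegment] using hz)
  have h1 := Nat.find_spec h
  have h2 := not_not.1 (Nat.find_min h (m := k) (by omega))
  rw [hk, initialSegment_succ, ← List.append_assoc] at h1
  obtain ⟨κ, hκ⟩ := h2.exists_of_dip h1
  exact ⟨k + 1, κ, by rw [initialSegment_succ, ← List.append_assoc, hκ]⟩

theorem confusable_of_lt_choose [Fintype X] [Finite M] [Finite A] (q₀ : M × List A) {r : ℕ}
    (hr : 0 < r)
    (hK : Nat.card S.Sig * (r * (Nat.card S.Sig * 2 ^ r) + 1) < (Fintype.card X).choose r) :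
    S.Confusable q₀ := by
  classical
  have : Finite {l : List A // l.length ≤ S.depth} := List.finite_length_le A S.depth
  have := Fintype.ofFinite S.Sig
  rw [Nat.card_eq_fintype_card] at hK
  have hloop : ∀ P : Finset X, ∃ s z : List X, P.Nonempty → (∀ a, a ∈ s ↔ a ∈ P) ∧
      (∀ a, a ∈ z ↔ a ∈ P) ∧ S.IsLoop (S.sig (S.run q₀ s)) z := by
    intro P
    by_cases hP : P.Nonempty
    · obtain ⟨s, z, h⟩ := S.exists_loop q₀ P hP
      exact ⟨s, z, fun _ => h⟩
    · exact ⟨[], [], fun h => absurd h hP⟩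
  choose s z hsz using hloop
  -- First pigeonhole: more than r·K·2^r + 1 of the r-sets share a signature `σ`.
  obtain ⟨σ, -, hσ⟩ := Finset.exists_lt_card_fiber_of_mul_lt_card_of_maps_to
    (s := Finset.powersetCard r (Finset.univ : Finset X)) (t := (Finset.univ : Finset S.Sig))
    (f := fun P => S.sig (S.run q₀ (s P))) (fun _ _ => Finset.mem_univ _)
    (by simpa using hK)
  set F := {P ∈ Finset.powersetCard r (Finset.univ : Finset X) | S.sig (S.run q₀ (s P)) = σ}
    with hF
  have hFr : ∀ P ∈ F, P.card = r := by simp +contextual [hF]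
  have hFσ : ∀ P ∈ F, S.sig (S.run q₀ (s P)) = σ := by simp +contextual [hF]
  have hne : ∀ P ∈ F, P.Nonempty := fun P hP => Finset.card_pos.1 (by rw [hFr P hP]; exact hr)
  have hs : ∀ P ∈ F, ∀ a, a ∈ s P ↔ a ∈ P := fun P hP => (hsz P (hne P hP)).1
  have hz : ∀ P ∈ F, ∀ a, a ∈ z P ↔ a ∈ P := fun P hP => (hsz P (hne P hP)).2.1
  have hl : ∀ P ∈ F, S.IsLoop σ (z P) := fun P hP => hFσ P hP ▸ (hsz P (hne P hP)).2.2
  obtain ⟨P₁, hP₁⟩ : F.Nonempty := Finset.card_pos.1 (by omega)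
  have hmiss : ∀ P ∈ F.erase P₁, ∃ x, x ∈ P₁ ∧ x ∉ P := by
    intro P hP
    obtain ⟨hP, hPF⟩ := Finset.mem_erase.1 hP
    by_contra! hc
    exact hP (Finset.eq_of_subset_of_card_le hc (by rw [hFr P hPF, hFr P₁ hP₁])).symm
  have hmiss' : ∀ P : Finset X, ∃ x, P ∈ F.erase P₁ → x ∈ P₁ ∧ x ∉ P := by
    intro P
    by_cases hP : P ∈ F.erase P₁
    · exact (hmiss P hP).imp fun x h _ => h
    · exact ⟨(hne P₁ hP₁).choose, fun h => absurd h hP⟩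
  choose miss hmiss' using hmiss'
  -- Second pigeonhole: each other set lacks one of the r letters of `P₁`, so more than K·2^r of
  -- them lack the same `x`.
  obtain ⟨x, hx, hQ⟩ := Finset.exists_lt_card_fiber_of_mul_lt_card_of_maps_to
    (s := F.erase P₁) (t := P₁) (f := miss) (fun P hP => (hmiss' P hP).1)
    (n := Fintype.card S.Sig * 2 ^ r)
    (by rw [hFr P₁ hP₁, Finset.card_erase_of_mem hP₁]; omega)
  set Q := {P ∈ F.erase P₁ | miss P = x} with hQdef
  have hQF : ∀ P ∈ Q, P ∈ F := fun P hP =>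
    Finset.mem_of_mem_erase (Finset.mem_filter.1 hP).1
  have hxQ : ∀ P ∈ Q, x ∉ P := fun P hP =>
    (Finset.mem_filter.1 hP).2 ▸ (hmiss' P (Finset.mem_filter.1 hP).1).2
  obtain ⟨P, hP⟩ : Q.Nonempty := Finset.card_pos.1 (by omega)
  have hPF := hQF P hP
  -- Outside `P`, the continuation avoids all letters of the sets in `Q`: in the first case below
  -- the loops supply them, in the second case they must stay unread.
  obtain ⟨w, hw⟩ := ({a | a ≠ x ∧ (a ∈ P ∨ ∀ P' ∈ Q, a ∉ P')} : Set X).to_countable.exists_eq_range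
    (by
      obtain ⟨a, ha⟩ := hne P hPF
      exact ⟨a, by rintro rfl; exact hxQ P hP ha, Or.inl ha⟩)
  by_cases hdip : ∃ P' ∈ Q, ∀ k, S.Stays (S.run q₀ (s P)) (z P' ++ initialSegment w k)
  · obtain ⟨P', hP', hst⟩ := hdip
    -- All loops of `Q` are read to supply their letters. They restore `σ`, so the final `z P'`
    -- followed by `w` still does not drop.
    set y := Q.toList.flatMap z ++ z P' with hy
    have hyl : S.IsLoop σ (Q.toList.flatMap z) :=
      isLoop_flatMap _ fun P hP => hl P (hQF P (Finset.mem_toList.1 hP))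
    have hmem : ∀ a, a ∈ y ↔ ∃ P ∈ Q, a ∈ P := by
      intro a
      simp only [hy, List.mem_append, List.mem_flatMap, Finset.mem_toList]
      constructor
      · rintro (⟨R, hR, ha⟩ | ha)
        · exact ⟨R, hR, (hz R (hQF R hR) a).1 ha⟩
        · exact ⟨P', hP', (hz P' (hQF P' hP') a).1 ha⟩
      · rintro ⟨R, hR, ha⟩
        exact Or.inl ⟨R, hR, (hz R (hQF R hR) a).2 ha⟩
    have hstay : ∀ k, S.Stays (S.run q₀ (s P)) (y ++ initialSegment w k) := by
      intro k
      obtain ⟨h1, h2⟩ := hyl _ (hFσ P hPF)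
      rw [hy, List.append_assoc]
      exact h1.append ((hst k).congr (by rw [h2, hFσ P hPF]))
    refine ⟨x, s P ++ y, s P₁ ++ y, w, fun a => ?_, fun a => ?_, ?_⟩
    · rw [← hw, List.mem_append, hs P hPF, hmem]
      constructor
      · rintro ((h | ⟨R, hR, h⟩) | h)
        · rintro rfl; exact hxQ P hP h
        · rintro rfl; exact hxQ R hR h
        · exact h.1
      · intro ha
        by_cases h : ∃ R ∈ Q, a ∈ R
        · exact Or.inl (Or.inr h)
        · push Not at h
          exact Or.inr ⟨ha, Or.inr h⟩
    · rw [← hw, List.mem_append, hs P₁ hP₁, hmem]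
      by_cases ha : a = x
      · exact Or.inl (Or.inl (ha ▸ hx))
      · by_cases h : ∃ R ∈ Q, a ∈ R
        · exact Or.inl (Or.inr h)
        · push Not at h
          exact Or.inr ⟨ha, Or.inr h⟩
    · intro k a
      rw [List.append_assoc (s P), List.append_assoc (s P₁), S.run_append q₀ (s P),
        S.run_append q₀ (s P₁)]
      exact (hstay k).out_run_eq (by rw [hFσ P hPF, hFσ P₁ hP₁]) a
  · push Not at hdip
    have hd : ∀ P' : Finset X, ∃ (k : ℕ) (κ : S.Sig), P' ∈ Q →
        S.run (S.run q₀ (s P)) (z P' ++ initialSegment w k) =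
          (κ.1, κ.2.1 ++ (S.run q₀ (s P)).2.drop S.depth) := by
      intro P'
      by_cases hP' : P' ∈ Q
      · obtain ⟨k, κ, h⟩ := exists_dip (hl P' (hQF P' hP') _ (hFσ P hPF)).1
          (not_forall.2 (hdip P' hP'))
        exact ⟨k, κ, fun _ => h⟩
      · exact ⟨0, σ, fun h => absurd h hP'⟩
    choose k κ hkκ using hd
    -- Third pigeonhole: the configuration after the drop depends only on `κ`. Equal traces on `P`
    -- ensure that a letter of `R` outside `R'` is not in `P` either.
    obtain ⟨R, hR, R', hR', hRR, heq⟩ := Finset.exists_ne_map_eq_of_card_lt_of_maps_to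
      (s := Q) (t := (Finset.univ : Finset S.Sig) ×ˢ P.powerset)
      (f := fun R => (κ R, R ∩ P))
      (by rw [Finset.card_product, Finset.card_powerset, hFr P hPF]; exact hQ)
      (by intro R _; simp)
    have hrun : S.run q₀ (s P ++ (z R ++ initialSegment w (k R))) =
        S.run q₀ (s P ++ (z R' ++ initialSegment w (k R'))) := by
      have := congrArg Prod.fst heq
      simp only at this
      rw [S.run_append q₀ (s P), S.run_append q₀ (s P), hkκ R hR, hkκ R' hR', this]
    have hcap : R ∩ P = R' ∩ P := congrArg Prod.snd heq
    obtain ⟨e, he, he'⟩ := Finset.not_subset.1 fun h : R ⊆ R' =>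
      hRR (Finset.eq_of_subset_of_card_le h (by rw [hFr R (hQF R hR), hFr R' (hQF R' hR')]))
    have heP : e ∉ P := fun h =>
      he' (Finset.mem_inter.1 (hcap ▸ Finset.mem_inter.2 ⟨he, h⟩)).1
    have hew : e ∉ Set.range w := by
      rw [← hw]
      rintro ⟨-, h | h⟩
      · exact heP h
      · exact h R hR he
    have h1 : e ∈ s P ++ (z R ++ initialSegment w (k R)) := by
      simp [hz R (hQF R hR), he]
    have h2 : e ∉ s P ++ (z R' ++ initialSegment w (k R')) := by
      simp only [List.mem_append, hs P hPF, hz R' (hQF R' hR'), mem_initialSegment]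
      rintro (h | h | ⟨i, -, h⟩)
      · exact heP h
      · exact he' h
      · exact hew ⟨i, h⟩
    exact confusable_of_run_eq (b := x) (by rintro rfl; exact hxQ R hR he) h2 h1 hrun.symm

end StackTransducer

/-! ### Decoding convolutions -/

section Convolution

variable {σ η γ ω : Type}

theorem blank_notMem_zipWithAll_output (m : List γ) (h : List η) :
    (BaseSym.blank : BaseSym σ η γ ω) ∉ List.zipWithAll BaseSym.output m h := by
  intro hb
  obtain ⟨i, hi⟩ := List.mem_iff_getElem?.1 hb
  rw [List.getElem?_zipWithAll] at hi
  revert hi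
  cases m[i]? <;> cases h[i]? <;> simp

/-- The memory component of an output symbol. -/
def BaseSym.memPart : BaseSym σ η γ ω → Option γ
  | output m _ => m
  | _ => none

/-- The hypothesis component of an output symbol. -/
def BaseSym.hypPart : BaseSym σ η γ ω → Option η
  | output _ h => h
  | _ => none

theorem filterMap_memPart (m : List γ) (h : List η) :
    (List.zipWithAll (BaseSym.output (σ := σ) (ω := ω)) m h).filterMap BaseSym.memPart = m := by
  induction m generalizing h with
  | nil => simp [List.filterMap_map, Function.comp_def, BaseSym.memPart]
  | cons a m ih =>
    cases h with
    | nil => simp [List.filterMap_map, Function.comp_def, BaseSym.memPart]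
    | cons b h => simp [ih, BaseSym.memPart]

theorem filterMap_hypPart (m : List γ) (h : List η) :
    (List.zipWithAll (BaseSym.output (σ := σ) (ω := ω)) m h).filterMap BaseSym.hypPart = h := by
  induction m generalizing h with
  | nil => simp [List.filterMap_map, Function.comp_def, BaseSym.hypPart]
  | cons a m ih =>
    cases h with
    | nil => simp [BaseSym.hypPart]
    | cons b h => simp [ih, BaseSym.hypPart]

end Convolution

/-! ### From learners to stack transducers -/

namespace Learner

theorem Holds.eq_of_length_le {σ η γ ω : Type} {t : ℕ → BaseSym σ η γ ω}
    {u u' : List (BaseSym σ η γ ω)} (h : Holds t u) (h' : Holds t u')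
    (hb : BaseSym.blank ∉ u') (hl : u.length ≤ u'.length) : u = u' := by
  have hlen : u.length = u'.length := by
    refine hl.antisymm (not_lt.1 fun hlt => hb ?_)
    -- If `u` were shorter, the blank ending it would be a symbol of `u'`.
    have h1 := (h u.length le_rfl).symm.trans (h' u.length hl)
    simp only [tapeOf, List.getElem?_eq_none le_rfl, Option.getD_none,
      List.getElem?_eq_getElem hlt, Option.getD_some] at h1
    exact h1 ▸ List.getElem_mem hlt
  refine List.ext_getElem hlen fun i hi hi' => ?_
  have h1 := (h i hi.le).symm.trans (h' i hi'.le)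
  simpa [tapeOf, hi, hi'] using h1

theorem Holds.unique {σ η γ ω : Type} {t : ℕ → BaseSym σ η γ ω} {m m' : List γ} {h h' : List η}
    (H : Holds t (List.zipWithAll BaseSym.output m h))
    (H' : Holds t (List.zipWithAll BaseSym.output m' h')) : m = m' ∧ h = h' := by
  have key : List.zipWithAll (BaseSym.output (σ := σ) (ω := ω)) m h =
      List.zipWithAll BaseSym.output m' h' := by
    rcases le_total (List.zipWithAll (BaseSym.output (σ := σ) (ω := ω)) m h).length
      (List.zipWithAll (BaseSym.output (σ := σ) (ω := ω)) m' h').length with hl | hl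
    · exact H.eq_of_length_le H' (blank_notMem_zipWithAll_output _ _) hl
    · exact (H'.eq_of_length_le H (blank_notMem_zipWithAll_output _ _) hl).symm
  constructor
  · rw [← filterMap_memPart (σ := σ) (ω := ω) m h, key, filterMap_memPart]
  · rw [← filterMap_hypPart (σ := σ) (ω := ω) m h, key, filterMap_hypPart]

variable {σ η : Type} {M : Learner σ η}

theorem iterate_step_eq_of_accept {c : M.Config} {t t' : ℕ}
    (h : M.accept (M.step^[t] c).state = true) (ht : t ≤ t') : M.step^[t'] c = M.step^[t] c := by
  obtain ⟨k, rfl⟩ := Nat.exists_eq_add_of_le' ht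
  rw [Function.iterate_add_apply]
  exact Function.iterate_fixed (by simp [step, h]) k

theorem Cycle.unique {b b' : ℕ} {mem : List M.Mem} {stk : List M.Stk} {w : List σ}
    {mem₁ mem₂ : List M.Mem} {h₁ h₂ : List η} {stk₁ stk₂ : List M.Stk}
    (H₁ : M.Cycle b mem stk w mem₁ h₁ stk₁) (H₂ : M.Cycle b' mem stk w mem₂ h₂ stk₂) :
    mem₁ = mem₂ ∧ h₁ = h₂ ∧ stk₁ = stk₂ := by
  obtain ⟨t, -, c, rfl, ha, ho, rfl⟩ := H₁
  obtain ⟨t', -, c', rfl, ha', ho', rfl⟩ := H₂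
  have key : M.step^[t] (M.startConfig mem stk w) = M.step^[t'] (M.startConfig mem stk w) := by
    rcases le_total t t' with h | h
    · exact (iterate_step_eq_of_accept ha h).symm
    · exact iterate_step_eq_of_accept ha' h
  rw [← key] at ho' ⊢
  exact ⟨(ho.unique ho').1, (ho.unique ho').2, rfl⟩

/-- A step inspects only the top symbol and pops at most one, so a nonempty upper part hides the
rest of the stack. -/
theorem exists_step_append (c : M.Config) {u : List M.Stk} (hu : u ≠ []) :
    ∃ (c' : M.Config) (u' : List M.Stk), u.length ≤ u'.length + 1 ∧
      ∀ v, M.step { c with stack := u ++ v } = { c' with stack := u' ++ v } := by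
  obtain ⟨a, u, rfl⟩ := List.exists_cons_of_ne_nil hu
  by_cases hc : M.accept c.state = true
  · exact ⟨c, a :: u, by simp, fun v => by simp [step, hc]⟩
  · obtain ⟨u', hu', hop⟩ : ∃ u' : List M.Stk, (a :: u).length ≤ u'.length + 1 ∧
        ∀ v, (M.trans c.state (M.scan c) (some a)).2.2.2.apply (a :: u ++ v) = u' ++ v := by
      cases (M.trans c.state (M.scan c) (some a)).2.2.2 with
      | keep => exact ⟨a :: u, by simp, fun v => rfl⟩
      | push b => exact ⟨b :: a :: u, by simp, fun v => rfl⟩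
      | pop => exact ⟨u, by simp, fun v => rfl⟩
    refine ⟨M.step { c with stack := [a] }, u', hu', fun v => ?_⟩
    have hs : ∀ l, M.scan { c with stack := l } = M.scan c := fun _ => rfl
    simp only [step, hc, hs, List.cons_append, List.head?_cons]
    simp only [Bool.false_eq_true, if_false, Config.mk.injEq]
    exact ⟨trivial, rfl, trivial, hop v⟩

theorem exists_iterate_step_append (c : M.Config) (u : List M.Stk) {t : ℕ} (ht : t ≤ u.length) :
    ∃ (c' : M.Config) (u' : List M.Stk), u.length ≤ u'.length + t ∧
      ∀ v, M.step^[t] { c with stack := u ++ v } = { c' with stack := u' ++ v } := by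
  induction t with
  | zero => exact ⟨c, u, by simp, fun v => rfl⟩
  | succ t ih =>
    obtain ⟨c₁, u₁, h₁, hc₁⟩ := ih (by omega)
    obtain ⟨c₂, u₂, h₂, hc₂⟩ := exists_step_append c₁ (u := u₁)
      (List.length_pos_iff.1 (by omega))
    exact ⟨c₂, u₂, by omega, fun v => by rw [Function.iterate_succ_apply', hc₁, hc₂]⟩

theorem Cycle.exists_append {b : ℕ} {mem : List M.Mem} {u v : List M.Stk} {w : List σ}
    {mem' : List M.Mem} {h : List η} {stk' : List M.Stk} (hb : b ≤ u.length)
    (H : M.Cycle b mem (u ++ v) w mem' h stk') :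
    ∃ u', ∀ v', M.Cycle b mem (u ++ v') w mem' h (u' ++ v') := by
  obtain ⟨t, ht, c, rfl, ha, ho, rfl⟩ := H
  obtain ⟨c', u', -, hc'⟩ := exists_iterate_step_append (M.startConfig mem [] w) u (ht.trans hb)
  have hs : ∀ l, M.startConfig mem l w = { M.startConfig mem [] w with stack := l } :=
    fun _ => rfl
  rw [hs, hc'] at ha ho
  exact ⟨u', fun v' => ⟨t, ht, _, rfl, by rw [hs, hc']; exact ha, by rw [hs, hc']; exact ho,
    by rw [hs, hc']⟩⟩

variable (M)

/-- A cycle takes at most `b` steps and leaves a memory word of length at most `l`. -/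
def BoundedCycle (b l : ℕ) (q : {m : List M.Mem // m.length ≤ l} × List M.Stk) (w : List σ)
    (r : ({m : List M.Mem // m.length ≤ l} × List M.Stk) × List η) : Prop :=
  M.Cycle b q.1 q.2 w r.1.1 r.2 r.1.2

open Classical in
/-- The result of a cycle, if its time and memory usage are within the bounds. -/
noncomputable def cycleResult (b l : ℕ) (q : {m : List M.Mem // m.length ≤ l} × List M.Stk)
    (w : List σ) : ({m : List M.Mem // m.length ≤ l} × List M.Stk) × List η :=
  if h : ∃ r, M.BoundedCycle b l q w r then h.choose else (q, [])

variable {M}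

theorem BoundedCycle.cycleResult_eq {b l : ℕ} {q : {m : List M.Mem // m.length ≤ l} × List M.Stk}
    {w : List σ} {r : ({m : List M.Mem // m.length ≤ l} × List M.Stk) × List η}
    (h : M.BoundedCycle b l q w r) : M.cycleResult b l q w = r := by
  have hex : ∃ r, M.BoundedCycle b l q w r := ⟨r, h⟩
  rw [cycleResult, dif_pos hex]
  obtain ⟨h1, h2, h3⟩ := Cycle.unique hex.choose_spec h
  exact Prod.ext (Prod.ext (Subtype.ext h1) h3) h2

variable (M)

/-- The transducer which performs a cycle of the machine for every letter, where the letters stand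
for the words given by `word`. -/
noncomputable def transducer {X : Type} (word : X → List σ) (b l : ℕ) :
    StackTransducer X {m : List M.Mem // m.length ≤ l} M.Stk (List η) where
  depth := b
  next q x := (M.cycleResult b l q (word x)).1
  out q x := (M.cycleResult b l q (word x)).2
  locality := by
    intro m u x hu
    by_cases h : ∃ v r, M.BoundedCycle b l (m, u ++ v) (word x) r
    · obtain ⟨v, ⟨⟨m', s⟩, h'⟩, hr⟩ := h
      obtain ⟨u', hu'⟩ := Cycle.exists_append hu hr
      refine ⟨m', u', h', fun v' => ?_⟩
      have : M.BoundedCycle b l (m, u ++ v') (word x) ((m', u' ++ v'), h') := hu' v'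
      rw [this.cycleResult_eq]
      exact ⟨rfl, rfl⟩
    -- If no bottom `v` admits a bounded cycle, the default result applies to all of them and leaves
    -- the stack unchanged, so it is local too.
    · push Not at h
      refine ⟨m, u, [], fun v => ?_⟩
      have : ¬ ∃ r, M.BoundedCycle b l (m, u ++ v) (word x) r := not_exists.2 (h v)
      simp [cycleResult, dif_neg this]

variable {M}

theorem Run.hyp_eq {X : Type} {word : X → List σ} {c d n l : ℕ} (hw : ∀ x, (word x).length = n)
    (hl : n + d ≤ l) (hi : M.initMem.length ≤ l) {τ : ℕ → X} {hyp : ℕ → List η}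
    (h : M.Run c d (fun k => word (τ k)) hyp) (k : ℕ) :
    hyp k = (M.transducer word (c * (n + 1)) l).out ((M.transducer word (c * (n + 1)) l).run
      (⟨M.initMem, hi⟩, []) (initialSegment τ k)) (τ k) := by
  obtain ⟨mem, stk, h0, h0', h⟩ := h
  have hlong : ∀ k, longest (fun k => word (τ k)) k = n := by
    intro k
    simp only [longest, hw]
    exact Finset.sup_const (by simp) n
  simp only [hlong] at h
  have hmem : ∀ k, (mem k).length ≤ l := by
    rintro (_ | k)
    · rw [h0]; exact hi
    · exact (h k).2.1.trans hl
  have hres : ∀ k, M.cycleResult (c * (n + 1)) l (⟨mem k, hmem k⟩, stk k) (word (τ k)) =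
      ((⟨mem (k + 1), hmem (k + 1)⟩, stk (k + 1)), hyp k) :=
    fun k => BoundedCycle.cycleResult_eq (h k).1
  have hrun : ∀ k, (M.transducer word (c * (n + 1)) l).run (⟨M.initMem, hi⟩, [])
      (initialSegment τ k) = (⟨mem k, hmem k⟩, stk k) := by
    intro k
    induction k with
    | zero => simp [initialSegment, h0, h0']
    | succ k ih =>
      rw [initialSegment_succ, StackTransducer.run_concat, ih]
      exact congrArg Prod.fst (hres k)
  rw [hrun]
  exact (congrArg Prod.snd (hres k)).symm

end Learner

/-! ### Texts and binary words -/

/-- The finite word `s` followed by the sequence `w`. -/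
def appendSequence {X : Type*} (s : List X) (w : ℕ → X) (k : ℕ) : X :=
  if h : k < s.length then s[k] else w (k - s.length)

theorem appendSequence_add {X : Type*} (s : List X) (w : ℕ → X) (k : ℕ) :
    appendSequence s w (s.length + k) = w k := by
  simp [appendSequence]

theorem initialSegment_appendSequence {X : Type*} (s : List X) (w : ℕ → X) (k : ℕ) :
    initialSegment (appendSequence s w) (s.length + k) = s ++ initialSegment w k := by
  rw [initialSegment_add]
  congr 1
  · refine List.ext_getElem (by simp [initialSegment]) fun i hi hi' => ?_
    simp [initialSegment, appendSequence, hi']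
  · simp only [appendSequence_add]

theorem mem_range_appendSequence {X : Type*} {s : List X} {w : ℕ → X} {a : X} :
    a ∈ Set.range (appendSequence s w) ↔ a ∈ s ∨ a ∈ Set.range w := by
  constructor
  · rintro ⟨k, rfl⟩
    unfold appendSequence
    split_ifs with h
    · exact Or.inl (List.getElem_mem h)
    · exact Or.inr ⟨_, rfl⟩
  · rintro (h | ⟨k, rfl⟩)
    · obtain ⟨k, hk, rfl⟩ := List.mem_iff_getElem.1 h
      exact ⟨k, by simp [appendSequence, hk]⟩
    · exact ⟨s.length + k, appendSequence_add s w k⟩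

/-- The binary word given by a sequence of truth values. -/
def binaryWord {n : ℕ} (v : Fin n → Bool) : List (Fin 3) :=
  List.ofFn fun i => if v i then 1 else 0

section binaryWord

variable {n : ℕ}

theorem length_binaryWord (v : Fin n → Bool) : (binaryWord v).length = n := by
  simp [binaryWord]

theorem binaryWord_binary (v : Fin n → Bool) : ∀ a ∈ binaryWord v, a = 0 ∨ a = 1 := by
  intro a ha
  obtain ⟨i, rfl⟩ := (List.mem_ofFn' _ _).1 ha
  cases v i <;> simp

theorem binaryWord_injective : Function.Injective (binaryWord (n := n)) := by
  intro v v' h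
  funext i
  have := congrFun (List.ofFn_injective h) i
  revert this
  cases v i <;> cases v' i <;> simp

theorem exists_binaryWord_eq {x : List (Fin 3)} (hx : x.length = n)
    (hb : ∀ a ∈ x, a = 0 ∨ a = 1) : ∃ v : Fin n → Bool, binaryWord v = x := by
  subst hx
  refine ⟨fun i => x[i] = 1, ?_⟩
  conv_rhs => rw [← List.ofFn_getElem (xs := x)]
  unfold binaryWord
  congr 1
  funext i
  rcases hb x[(i : ℕ)] (List.getElem_mem _) with h | h <;> simp [h]

theorem lang_binaryWord (x : Fin n → Bool) :
    lang (binaryWord x) = binaryWord '' {x}ᶜ := by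
  ext y
  constructor
  · rintro ⟨h1, h2, h3⟩
    rw [length_binaryWord] at h1
    obtain ⟨v, rfl⟩ := exists_binaryWord_eq h1 h2
    exact ⟨v, fun h => h3 (congrArg _ h), rfl⟩
  · rintro ⟨v, hv, rfl⟩
    exact ⟨by simp [length_binaryWord], binaryWord_binary v, fun h => hv (binaryWord_injective h)⟩

theorem lang_replicate (hn : 0 < n) :
    lang (List.replicate n 2) = Set.range (binaryWord (n := n)) := by
  ext y
  constructor
  · rintro ⟨h1, h2, h3⟩
    rw [List.length_replicate] at h1
    exact exists_binaryWord_eq h1 h2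
  · rintro ⟨v, rfl⟩
    refine ⟨by simp [length_binaryWord], binaryWord_binary v, fun h => ?_⟩
    have h2 : (2 : Fin 3) ∈ binaryWord v := by
      rw [h]; exact List.mem_replicate.2 ⟨hn.ne', rfl⟩
    rcases binaryWord_binary v 2 h2 with h | h <;> revert h <;> decide

theorem binaryWord_mem_indexSet (v : Fin n → Bool) : binaryWord v ∈ indexSet :=
  Or.inl (binaryWord_binary v)

theorem replicate_mem_indexSet : List.replicate n 2 ∈ indexSet :=
  Or.inr fun _ ha => List.eq_of_mem_replicate ha

end binaryWord

/-! ### Counting signatures -/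

theorem card_lists_le (A : Type) [Finite A] (b : ℕ) :
    Nat.card {l : List A // l.length ≤ b} ≤ (Nat.card A + 1) ^ b := by
  have hinj : Function.Injective
      fun (l : {l : List A // l.length ≤ b}) (i : Fin b) => l.1[(i : ℕ)]? := by
    rintro ⟨l, hl⟩ ⟨l', hl'⟩ h
    refine Subtype.ext (List.ext_getElem? fun i => ?_)
    rcases lt_or_ge i b with hi | hi
    · exact congrFun h ⟨i, hi⟩
    · simp only
      rw [List.getElem?_eq_none (hl.trans hi), List.getElem?_eq_none (hl'.trans hi)]
  refine (Nat.card_le_card_of_injective _ hinj).trans ?_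
  rw [Nat.card_fun, Finite.card_option, Nat.card_fin]

/-- The left side is of order K², at most 2^(2gn) up to a constant if G ≤ 2^g, while the binomial
coefficient grows like 2^(rn). Any r > 2g would do for large n; `r = 2 * g + 2` leaves room. -/
theorem exists_lt_choose (G : ℕ) : ∃ r n : ℕ, 0 < r ∧ 0 < n ∧ ∀ K ≤ G ^ (n + 1),
    K * (r * (K * 2 ^ r) + 1) < (2 ^ n).choose r := by
  obtain ⟨g, hg⟩ : ∃ g, G ≤ 2 ^ g := ⟨G, Nat.lt_two_pow_self.le⟩
  obtain ⟨r, hr⟩ : ∃ r, r = 2 * g + 2 := ⟨_, rfl⟩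
  obtain ⟨C, hC⟩ : ∃ C, C = r.factorial * (2 * r * 2 ^ r * 2 ^ (4 * g + 2)) := ⟨_, rfl⟩
  obtain ⟨n, hn⟩ : ∃ n, n = C + r := ⟨_, rfl⟩
  refine ⟨r, n + 1, by omega, by omega, fun K hK => ?_⟩
  have hK' : K ≤ 2 ^ (g * (n + 2)) :=
    hK.trans ((Nat.pow_le_pow_left hg _).trans_eq (by rw [← pow_mul]))
  have hle : K * (r * (K * 2 ^ r) + 1) ≤ 2 * r * 2 ^ r * 2 ^ (2 * (g * (n + 2))) := by
    rcases Nat.eq_zero_or_pos K with rfl | hpos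
    · simp
    · have h1 : 1 ≤ r * (K * 2 ^ r) := Nat.mul_pos (by omega) (by positivity)
      calc K * (r * (K * 2 ^ r) + 1) ≤ K * (r * (K * 2 ^ r) + r * (K * 2 ^ r)) := by gcongr
        _ = 2 * r * 2 ^ r * (K * K) := by ring
        _ ≤ 2 * r * 2 ^ r * (2 ^ (g * (n + 2)) * 2 ^ (g * (n + 2))) := by gcongr
        _ = _ := by rw [← pow_add]; ring_nf
  have hch : (2 ^ n) ^ r ≤ r.factorial * (2 ^ (n + 1)).choose r := by
    have h1 : (2 ^ (n + 1) + 1 - r) ^ r ≤ r.factorial * (2 ^ (n + 1)).choose r :=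
      (Nat.pow_sub_le_descFactorial _ _).trans_eq (Nat.descFactorial_eq_factorial_mul_choose _ _)
    refine (Nat.pow_le_pow_left ?_ r).trans h1
    have : n < 2 ^ n := Nat.lt_two_pow_self
    rw [pow_succ]
    omega
  have hlt : r.factorial * (2 * r * 2 ^ r * 2 ^ (2 * (g * (n + 2)))) < (2 ^ n) ^ r := by
    have h1 : C < 2 ^ n := lt_of_le_of_lt (by omega) (Nat.lt_two_pow_self (n := n))
    calc r.factorial * (2 * r * 2 ^ r * 2 ^ (2 * (g * (n + 2))))
        ≤ r.factorial * (2 * r * 2 ^ r * 2 ^ (4 * g + 2 + 2 * g * n)) := by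
          gcongr
          · norm_num
          · nlinarith
      _ = C * 2 ^ (2 * g * n) := by rw [hC, pow_add]; ring
      _ < 2 ^ n * 2 ^ (2 * g * n) := by gcongr
      _ ≤ (2 ^ n) ^ r := by
          rw [← pow_mul, ← pow_add, hr]
          exact Nat.pow_le_pow_right (by norm_num) (by nlinarith)
  by_contra hcon
  have := Nat.mul_le_mul_left r.factorial ((not_lt.1 hcon).trans hle)
  omega

theorem Learner.card_sig_le {η : Type} (M : Learner (Fin 3) η) (c d n : ℕ) {X : Type}
    (word : X → List (Fin 3)) :
    Nat.card (M.transducer word (c * (n + 1)) (n + d)).Sig ≤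
      ((Nat.card M.Mem + 1) ^ (d + 1) * (Nat.card M.Stk + 1) ^ c) ^ (n + 1) := by
  have := M.finite_mem
  have := M.finite_stk
  rw [Nat.card_prod, mul_pow, ← pow_mul, ← pow_mul]
  refine Nat.mul_le_mul ((card_lists_le M.Mem _).trans ?_) (card_lists_le M.Stk _)
  exact Nat.pow_le_pow_right (Nat.succ_pos _) (by nlinarith)

end StackLearning

open StackLearning in
theorem theorem3p9 (η : Type) [Finite η] (J : Set (List η))
    (H : List η → Set (List (Fin 3))) :
    ¬ ∃ M : StackLearning.Learner (Fin 3) η,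
      M.LinearTimeLearns J H (StackLearning.lang '' StackLearning.indexSet) := by
  rintro ⟨M, c, d, hM⟩
  have := M.finite_mem
  have := M.finite_stk
  -- The initial memory may be longer than n + d, so its length is added to `d`.
  obtain ⟨r, n, hr, hn, hK⟩ := exists_lt_choose
    ((Nat.card M.Mem + 1) ^ (d + M.initMem.length + 1) * (Nat.card M.Stk + 1) ^ c)
  have hi : M.initMem.length ≤ n + (d + M.initMem.length) := by omega
  have : Finite {m : List M.Mem // m.length ≤ n + (d + M.initMem.length)} :=
    List.finite_length_le _ _
  obtain ⟨x, s, s', w, hs, hs', hout⟩ := StackTransducer.confusable_of_lt_choose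
    (S := M.transducer (binaryWord (n := n)) (c * (n + 1)) (n + (d + M.initMem.length)))
    (⟨M.initMem, hi⟩, []) hr
    (by
      rw [Fintype.card_fun, Fintype.card_bool, Fintype.card_fin]
      exact hK _ (M.card_sig_le c (d + M.initMem.length) n _))
  have htext : ∀ (t : List (Fin n → Bool)) (R : Set (Fin n → Bool)),
      (∀ a, (a ∈ t ∨ a ∈ Set.range w) ↔ a ∈ R) →
      IsText (fun k => binaryWord (appendSequence t w k)) (binaryWord '' R) := by
    intro t R hR
    have : Set.range (appendSequence t w) = R := by
      ext a
      rw [mem_range_appendSequence, hR]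
    rw [IsText, ← this, ← Set.range_comp]
    rfl
  obtain ⟨hyp, hrun, e, -, he, k, hk⟩ := hM _ ⟨_, binaryWord_mem_indexSet x, rfl⟩ _
    (lang_binaryWord x ▸ htext s {x}ᶜ (by simpa using hs))
  obtain ⟨hyp', hrun', e', -, he', k', hk'⟩ := hM _ ⟨_, replicate_mem_indexSet, rfl⟩ _
    ((lang_replicate hn).trans Set.image_univ.symm ▸
      htext s' Set.univ (by simpa using hs'))
  -- After their different beginnings `s` and `s'`, both texts continue with `w` and receive the
  -- same conjectures.
  have heq : ∀ j, hyp (s.length + j) = hyp' (s'.length + j) := by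
    intro j
    rw [hrun.hyp_eq length_binaryWord (by omega) hi, hrun'.hyp_eq length_binaryWord (by omega) hi,
      initialSegment_appendSequence, initialSegment_appendSequence, appendSequence_add,
      appendSequence_add]
    exact hout j _
  have hee : e = e' := by
    rw [← hk (s.length + (k + k')) (by omega), heq, hk' _ (by omega)]
  have hx : binaryWord x ∈ lang (binaryWord x) := by
    rw [← he, hee, he', lang_replicate hn]
    exact ⟨x, rfl⟩
  exact hx.2.2 rfl
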